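/- Let $N,n\ge 1$, $\sigma>0$, let $A$ be a complex $N\times n$ matrix, $R\neq 0$ a positive semidefinite Hermitian $N\times N$ matrix and $T$ a positive definite Hermitian $n\times n$ matrix. Let $\mathcal C_1$ be the set of positive semidefinite Hermitian $n\times n$ matrices $\tilde Q$ with $\frac1n\mathrm{Tr}\,\tilde Q=1$, and for $\tilde Q\in\mathcal C_1$ put $T(\tilde Q)=\tilde Q^{1/2}T\tilde Q^{1/2}$. For every $\tilde Q\in\mathcal C_1$ the system $$\kappa=\tfrac1n\mathrm{Tr}\Big[R\big(\sigma^2(I+\tilde\kappa R)+A\tilde Q^{1/2}(I+\kappa T(\tilde Q))^{-1}\tilde Q^{1/2}A^H\big)^{-1}\Big],$$ $$\tilde\kappa=\tfrac1n\mathrm{Tr}\Big[T(\tilde Q)\big(\sigma^2(I+\kappa T(\tilde Q))+\tilde Q^{1/2}A^H(I+\tilde\kappa R)^{-1}A\tilde Q^{1/2}\big)^{-1}\Big]$$ has exactly one solution $(\kappa,\tilde\kappa)=(\delta(\tilde Q),\tilde\delta(\tilde Q))$ with $\kappa>0$ and $\tilde\kappa>0$. For $\kappa,\tilde\kappa>0$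 let $$G(\kappa,\tilde\kappa)=\Big[\kappa T+\tfrac1{\sigma^2}A^H(I+\tilde\kappa R)^{-1}A\Big]^{1/2},$$ and, for $\tilde Q\in\mathcal C_1$, writing $\delta=\delta(\tilde Q)$, $\tilde\delta=\tilde\delta(\tilde Q)$, let $$\overline I(\tilde Q)=\log\det\big[I+G(\delta,\tilde\delta)\,\tilde Q\,G(\delta,\tilde\delta)\big]+\log\det\big[I+\tilde\delta R\big]-\sigma^2 n\,\delta\,\tilde\delta .$$ Let $\tilde Q_*\in\mathcal C_1$ be a maximizer of $\overline I$ over $\mathcal C_1$, and let $\delta_*=\delta(\tilde Q_*)$, $\tilde\delta_*=\tilde\delta(\tilde Q_*)$. Then $\tilde Q_*$ is the solution of the standard water-filling problem: it is the unique maximizer over $\tilde Q\in\mathcal C_1$ of $$U(\tilde Q)=\log\det\big[I+G(\delta_*,\tilde\delta_*)\,\tilde Q\,G(\delta_*,\tilde\delta_*)\big].$$ -/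

import Mathlib

open scoped Matrix MatrixOrder ComplexOrder

noncomputable section

namespace MimoRician

variable {N n : ℕ}

/-- The positive semidefinite square root of a positive semidefinite Hermitian matrix. -/
def msqrt (M : Matrix (Fin n) (Fin n) ℂ) : Matrix (Fin n) (Fin n) ℂ := CFC.sqrt M

/-- `log det M`, for matrices `M` whose determinant is a positive real number. -/
def logDet {m : ℕ} (M : Matrix (Fin m) (Fin m) ℂ) : ℝ := Real.log M.det.re

/-- The set `𝒞₁` of nonnegative Hermitian `n × n` matrices `Q` with `(1/n) Tr Q = 1`. -/
def C1 (n : ℕ) : Set (Matrix (Fin n) (Fin n) ℂ) :=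
  {Q | Q.PosSemidef ∧ (1 / (n : ℂ)) * Q.trace = 1}

/-- `T(Q) = Q^{1/2} T Q^{1/2}`. -/
def TQ (T Q : Matrix (Fin n) (Fin n) ℂ) : Matrix (Fin n) (Fin n) ℂ :=
  msqrt Q * T * msqrt Q

/-- `f(κ, κ', Q) = (1/n) Tr [R (σ²(I + κ' R) + A Q^{1/2} (I + κ T(Q))⁻¹ Q^{1/2} Aᴴ)⁻¹]`.
The trace is real for nonnegative parameters. -/
def f (σ : ℝ) (A : Matrix (Fin N) (Fin n) ℂ) (R : Matrix (Fin N) (Fin N) ℂ)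
    (T : Matrix (Fin n) (Fin n) ℂ) (κ κ' : ℝ) (Q : Matrix (Fin n) (Fin n) ℂ) : ℝ :=
  (1 / (n : ℝ)) *
    (R * (((σ ^ 2 : ℝ) : ℂ) • (1 + (κ' : ℂ) • R) +
      A * msqrt Q * (1 + (κ : ℂ) • TQ T Q)⁻¹ * msqrt Q * Aᴴ)⁻¹).trace.re

/-- `f'(κ, κ', Q) = (1/n) Tr [T(Q) (σ²(I + κ T(Q)) + Q^{1/2} Aᴴ (I + κ' R)⁻¹ A Q^{1/2})⁻¹]`. -/
def f' (σ : ℝ) (A : Matrix (Fin N) (Fin n) ℂ) (R : Matrix (Fin N) (Fin N) ℂ)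
    (T : Matrix (Fin n) (Fin n) ℂ) (κ κ' : ℝ) (Q : Matrix (Fin n) (Fin n) ℂ) : ℝ :=
  (1 / (n : ℝ)) *
    (TQ T Q * (((σ ^ 2 : ℝ) : ℂ) • (1 + (κ : ℂ) • TQ T Q) +
      msqrt Q * Aᴴ * (1 + (κ' : ℂ) • R)⁻¹ * A * msqrt Q)⁻¹).trace.re

/-- `p = (κ, κ')` is a strictly positive solution of the system
`κ = f(κ, κ', Q)`, `κ' = f'(κ, κ', Q)`. -/
def IsCanonicalSolution (σ : ℝ) (A : Matrix (Fin N) (Fin n) ℂ) (R : Matrix (Fin N) (Fin N) ℂ)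
    (T Q : Matrix (Fin n) (Fin n) ℂ) (p : ℝ × ℝ) : Prop :=
  0 < p.1 ∧ 0 < p.2 ∧ p.1 = f σ A R T p.1 p.2 Q ∧ p.2 = f' σ A R T p.1 p.2 Q

open Classical in
/-- The strictly positive solution of the system (the value `(0, 0)` if there is none). -/
def canonicalSolution (σ : ℝ) (A : Matrix (Fin N) (Fin n) ℂ) (R : Matrix (Fin N) (Fin N) ℂ)
    (T Q : Matrix (Fin n) (Fin n) ℂ) : ℝ × ℝ :=
  if h : ∃ p, IsCanonicalSolution σ A R T Q p then h.choose else (0, 0)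

/-- `δ(Q)`. -/
def delta (σ : ℝ) (A : Matrix (Fin N) (Fin n) ℂ) (R : Matrix (Fin N) (Fin N) ℂ)
    (T Q : Matrix (Fin n) (Fin n) ℂ) : ℝ := (canonicalSolution σ A R T Q).1

/-- `δ̃(Q)`. -/
def delta' (σ : ℝ) (A : Matrix (Fin N) (Fin n) ℂ) (R : Matrix (Fin N) (Fin N) ℂ)
    (T Q : Matrix (Fin n) (Fin n) ℂ) : ℝ := (canonicalSolution σ A R T Q).2

/-- `G(κ, κ') = [κ T + σ⁻² Aᴴ (I + κ' R)⁻¹ A]^{1/2}`. -/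
def G (σ : ℝ) (A : Matrix (Fin N) (Fin n) ℂ) (R : Matrix (Fin N) (Fin N) ℂ)
    (T : Matrix (Fin n) (Fin n) ℂ) (κ κ' : ℝ) : Matrix (Fin n) (Fin n) ℂ :=
  msqrt ((κ : ℂ) • T + ((1 / σ ^ 2 : ℝ) : ℂ) • (Aᴴ * (1 + (κ' : ℂ) • R)⁻¹ * A))

/-- The large system approximation of the average mutual information,
`Ī(Q) = log det [I + H(Q) Q H(Q)] + log det [I + δ̃(Q) R] - σ² n δ(Q) δ̃(Q)`
with `H(Q) = G(δ(Q), δ̃(Q))`. -/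
def Ibar (σ : ℝ) (A : Matrix (Fin N) (Fin n) ℂ) (R : Matrix (Fin N) (Fin N) ℂ)
    (T Q : Matrix (Fin n) (Fin n) ℂ) : ℝ :=
  logDet (1 + G σ A R T (delta σ A R T Q) (delta' σ A R T Q) * Q *
      G σ A R T (delta σ A R T Q) (delta' σ A R T Q)) +
    logDet (1 + (delta' σ A R T Q : ℂ) • R) -
    σ ^ 2 * n * delta σ A R T Q * delta' σ A R T Q

/-- The water-filling objective `U(Q) = log det [I + G(κ, κ') Q G(κ, κ')]`. -/
def waterfilling (σ : ℝ) (A : Matrix (Fin N) (Fin n) ℂ) (R : Matrix (Fin N) (Fin N) ℂ)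
    (T : Matrix (Fin n) (Fin n) ℂ) (κ κ' : ℝ) (Q : Matrix (Fin n) (Fin n) ℂ) : ℝ :=
  logDet (1 + G σ A R T κ κ' * Q * G σ A R T κ κ')

end MimoRician

end

/-! ### Matrix order, traces of inverses and tangent inequalities for log det. -/

noncomputable section

namespace MimoRician

variable {m k : ℕ}

/-! Write V(κ, κ̃, Q) for log det[I + GQG] + log det[I + κ̃R], and c = σ²n, so that Ī(Q) is V − cκκ̃
at (δ(Q), δ̃(Q)). Three properties of V carry the proof, and none needs any regularity of δ in Q. Up
to the term independent of Q, V is concave in Q, for fixed κ and κ̃. It is concave in κ̃ with slope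
cδ at the canonical point, so Ī(Q) ≥ V(δ(Q), p/δ(Q), Q) − cp for every p > 0
(`profile_sub_le_Ibar`). Along a curve κκ̃ = p it is strictly convex in log κ
(`strictConvexOn_logDetSum_exp`), and for p = δδ̃ the canonical equations make κ = δ its strict
minimum (`profile_lt_of_ne`). Suppose some Q' has U(Q') > U(Q*). Fix p = δ*δ̃* and move slightly
from Q* towards Q'. Near κ = δ* concavity in Q raises V above its old minimum, and convexity along
the curve keeps it above that value elsewhere (`exists_forall_lt_of_convexOn`). Evaluating at the
unknown δ of the new matrix and using the lower bound for Ī contradicts maximality. The maximizer of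
U is unique because G is invertible, which makes U strictly concave. The same monotonicity that
gives convexity in log κ, together with a scaling inequality, gives uniqueness of (δ, δ̃); existence
comes from a monotone fixed point. -/

lemma posSemidef_ofReal_smul {M : Matrix (Fin m) (Fin m) ℂ} (hM : M.PosSemidef) {x : ℝ}
    (hx : 0 ≤ x) : ((x : ℂ) • M).PosSemidef :=
  hM.smul (by exact_mod_cast hx)

lemma posDef_one_add_smul {M : Matrix (Fin m) (Fin m) ℂ} (hM : M.PosSemidef) {x : ℝ}
    (hx : 0 ≤ x) : (1 + (x : ℂ) • M).PosDef :=
  Matrix.PosDef.one.add_posSemidef (posSemidef_ofReal_smul hM hx)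

/-- Inversion is antitone on positive definite matrices. -/
lemma posSemidef_inv_sub_inv {X Y : Matrix (Fin m) (Fin m) ℂ} (hX : X.PosDef)
    (h : (Y - X).PosSemidef) : (X⁻¹ - Y⁻¹).PosSemidef := by
  obtain ⟨D, rfl⟩ : ∃ D, Y = X + D := ⟨Y - X, by abel⟩
  rw [add_sub_cancel_left] at h
  have hY : (X + D).PosDef := hX.add_posSemidef h
  have uX := (Matrix.isUnit_iff_isUnit_det _).1 hX.isUnit
  have uY := (Matrix.isUnit_iff_isUnit_det _).1 hY.isUnit
  -- With Y = X + D, multiplying the difference by Y on both sides gives YX⁻¹Y − Y = D + DX⁻¹D, a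
  -- sum of positive semidefinite terms.
  have key : X⁻¹ - (X + D)⁻¹ = (X + D)⁻¹ * (D + D * X⁻¹ * D) * (X + D)⁻¹ := by
    have h1 : D + D * X⁻¹ * D = (X + D) * X⁻¹ * (X + D) - (X + D) := by
      simp only [add_mul, mul_add, Matrix.mul_nonsing_inv _ uX, one_mul, mul_assoc,
        Matrix.nonsing_inv_mul _ uX, mul_one]
      abel
    rw [h1, mul_sub, sub_mul, Matrix.nonsing_inv_mul _ uY, one_mul, ← mul_assoc, ← mul_assoc,
      Matrix.nonsing_inv_mul _ uY, one_mul, mul_assoc, Matrix.mul_nonsing_inv _ uY, mul_one]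
  have h2 : (D + D * X⁻¹ * D).PosSemidef := by
    refine h.add ?_
    have := hX.inv.posSemidef.mul_mul_conjTranspose_same D
    rwa [h.isHermitian.eq] at this
  have h3 := h2.mul_mul_conjTranspose_same (X + D)⁻¹
  rw [hY.inv.isHermitian.eq] at h3
  rw [key]
  exact h3

lemma re_trace_nonneg {M : Matrix (Fin m) (Fin m) ℂ} (hM : M.PosSemidef) : 0 ≤ M.trace.re :=
  (Complex.le_def.1 hM.trace_nonneg).1

lemma msqrt_posSemidef (M : Matrix (Fin m) (Fin m) ℂ) : (msqrt M).PosSemidef :=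
  Matrix.nonneg_iff_posSemidef.1 (CFC.sqrt_nonneg M)

lemma msqrt_mul_self {M : Matrix (Fin m) (Fin m) ℂ} (hM : M.PosSemidef) :
    msqrt M * msqrt M = M :=
  CFC.sqrt_mul_sqrt_self M (Matrix.nonneg_iff_posSemidef.2 hM)

lemma msqrt_conjTranspose (M : Matrix (Fin m) (Fin m) ℂ) : (msqrt M)ᴴ = msqrt M :=
  (msqrt_posSemidef M).isHermitian.eq

lemma re_trace_mul_nonneg {M P : Matrix (Fin m) (Fin m) ℂ} (hM : M.PosSemidef)
    (hP : P.PosSemidef) : 0 ≤ (M * P).trace.re := by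
  have h := re_trace_nonneg (hP.mul_mul_conjTranspose_same (msqrt M))
  rwa [msqrt_conjTranspose, Matrix.trace_mul_comm, ← mul_assoc, msqrt_mul_self hM] at h

lemma re_det_pos {M : Matrix (Fin m) (Fin m) ℂ} (hM : M.PosDef) : 0 < M.det.re :=
  (Complex.lt_def.1 hM.det_pos).1

lemma ofReal_re_det {M : Matrix (Fin m) (Fin m) ℂ} (hM : M.PosDef) : (M.det.re : ℂ) = M.det :=
  Complex.ext rfl (Complex.lt_def.1 hM.det_pos).2

/-- `log det Z < Tr Z - m` for positive definite `Z ≠ 1`. -/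
lemma logDet_lt_trace_sub {Z : Matrix (Fin m) (Fin m) ℂ} (hZ : Z.PosDef) (h : Z ≠ 1) :
    logDet Z < Z.trace.re - m := by
  have hpos := hZ.eigenvalues_pos
  have hdet : Z.det.re = ∏ i, hZ.1.eigenvalues i := by
    rw [hZ.1.det_eq_prod_eigenvalues]
    norm_cast
  have htr : Z.trace.re - m = ∑ i, (hZ.1.eigenvalues i - 1) := by
    rw [hZ.1.trace_eq_sum_eigenvalues]
    simp
  rw [logDet, hdet, Real.log_prod (fun i _ => (hpos i).ne'), htr]
  obtain ⟨i, hi⟩ : ∃ i, hZ.1.eigenvalues i ≠ 1 := by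
    by_contra! hcon
    apply h
    have := hZ.1.spectral_theorem
    rw [show (RCLike.ofReal ∘ hZ.1.eigenvalues : Fin m → ℂ) = 1 from
      funext fun i => by simp [hcon i]] at this
    rw [this]
    simp
  exact Finset.sum_lt_sum (fun j _ => Real.log_le_sub_one_of_pos (hpos j))
    ⟨i, Finset.mem_univ _, Real.log_lt_sub_one_of_pos (hpos i) hi⟩

/-- Strict concavity of `log det`, as a tangent inequality. -/
lemma logDet_lt_add_trace {X Y : Matrix (Fin m) (Fin m) ℂ} (hX : X.PosDef) (hY : Y.PosDef)
    (h : Y ≠ X) : logDet Y < logDet X + (X⁻¹ * (Y - X)).trace.re := by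
  have uX := (Matrix.isUnit_iff_isUnit_det _).1 hX.isUnit
  -- Congruence by X^{-1/2} moves the base point to the identity, where the eigenvalue bound log λ ≤
  -- λ − 1 applies.
  set S := msqrt X⁻¹ with hS
  have hSS : S * S = X⁻¹ := msqrt_mul_self hX.inv.posSemidef
  have hSH : Sᴴ = S := msqrt_conjTranspose _
  have uS : IsUnit S := by
    rw [Matrix.isUnit_iff_isUnit_det]
    have : IsUnit (S * S).det := by
      rw [hSS]; exact (Matrix.isUnit_iff_isUnit_det _).1 hX.inv.isUnit
    rw [Matrix.det_mul] at this
    exact isUnit_of_mul_isUnit_left this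
  have hZ : (S * Y * S).PosDef := by
    have := (Matrix.IsUnit.posDef_star_left_conjugate_iff (x := Y) uS).2 hY
    rwa [Matrix.star_eq_conjTranspose, hSH] at this
  have hne : S * Y * S ≠ 1 := by
    intro h1
    apply h
    rw [mul_assoc, mul_eq_one_comm, mul_assoc, hSS] at h1
    have := congrArg (· * X) h1
    simpa [mul_assoc, Matrix.nonsing_inv_mul _ uX] using this
  have h1 := logDet_lt_trace_sub hZ hne
  have htr : (S * Y * S).trace.re - m = (X⁻¹ * (Y - X)).trace.re := by
    rw [Matrix.trace_mul_comm, ← mul_assoc, hSS, mul_sub, Matrix.nonsing_inv_mul _ uX,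
      Matrix.trace_sub, Matrix.trace_one]
    simp
  have hdet : logDet (S * Y * S) = logDet Y - logDet X := by
    have e : X.det * (S * Y * S).det = Y.det := by
      rw [Matrix.det_mul_right_comm, hSS, Matrix.det_mul, ← mul_assoc, Matrix.det_nonsing_inv,
        Ring.mul_inverse_cancel _ uX, one_mul]
    rw [← ofReal_re_det hX, ← ofReal_re_det hZ, ← ofReal_re_det hY] at e
    have e' : X.det.re * (S * Y * S).det.re = Y.det.re := by exact_mod_cast e
    rw [logDet, logDet, logDet, ← e', Real.log_mul (re_det_pos hX).ne' (re_det_pos hZ).ne']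
    ring
  linarith

lemma logDet_le_add_trace {X Y : Matrix (Fin m) (Fin m) ℂ} (hX : X.PosDef) (hY : Y.PosDef) :
    logDet Y ≤ logDet X + (X⁻¹ * (Y - X)).trace.re := by
  by_cases h : Y = X
  · simp [h]
  · exact (logDet_lt_add_trace hX hY h).le

/-- Add the strict tangent inequalities for log det at X and at X + sR, each evaluated at the other
point: the log det terms cancel. This gives strictness even when R is singular. -/
lemma trace_mul_inv_strictAnti {X R : Matrix (Fin m) (Fin m) ℂ} (hX : X.PosDef)
    (hR : R.PosSemidef) (hR0 : R ≠ 0) {s : ℝ} (hs : 0 < s) :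
    (R * (X + (s : ℂ) • R)⁻¹).trace.re < (R * X⁻¹).trace.re := by
  have hY : (X + (s : ℂ) • R).PosDef := hX.add_posSemidef (posSemidef_ofReal_smul hR hs.le)
  have hne : X + (s : ℂ) • R ≠ X := by simp [hR0, hs.ne']
  have h1 := logDet_lt_add_trace hX hY hne
  have h2 := logDet_lt_add_trace hY hX hne.symm
  rw [add_sub_cancel_left, Matrix.mul_smul, Matrix.trace_smul, Matrix.trace_mul_comm] at h1
  rw [sub_add_cancel_left, Matrix.mul_neg, Matrix.mul_smul, Matrix.trace_neg, Matrix.trace_smul,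
    Matrix.trace_mul_comm] at h2
  simp only [smul_eq_mul, Complex.re_ofReal_mul, Complex.neg_re] at h1 h2
  nlinarith

lemma trace_mul_inv_pos {X R : Matrix (Fin m) (Fin m) ℂ} (hX : X.PosDef)
    (hR : R.PosSemidef) (hR0 : R ≠ 0) : 0 < (R * X⁻¹).trace.re := by
  refine (re_trace_mul_nonneg hR ?_).trans_lt (trace_mul_inv_strictAnti hX hR hR0 one_pos)
  exact (hX.add_posSemidef (posSemidef_ofReal_smul hR zero_le_one)).inv.posSemidef

/-- Equality of traces would make the positive semidefinite matrix X⁻¹ − Y⁻¹ traceless, hence zero.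
-/
lemma re_trace_inv_lt {X Y : Matrix (Fin m) (Fin m) ℂ} (hX : X.PosDef)
    (h : (Y - X).PosSemidef) (hne : X ≠ Y) : (Y⁻¹).trace.re < (X⁻¹).trace.re := by
  have hY : Y.PosDef := by simpa using hX.add_posSemidef h
  have h1 := posSemidef_inv_sub_inv hX h
  have h2 := re_trace_nonneg h1
  rw [Matrix.trace_sub, Complex.sub_re] at h2
  refine lt_of_le_of_ne (by linarith) fun he => hne ?_
  have h3 : (X⁻¹ - Y⁻¹).trace = 0 := by
    have := (Complex.le_def.1 h1.trace_nonneg).2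
    refine Complex.ext ?_ this.symm
    rw [Matrix.trace_sub, Complex.sub_re, he, sub_self]; rfl
  have h4 := sub_eq_zero.1 (h1.trace_eq_zero_iff.1 h3)
  exact Matrix.inv_inj h4 ((Matrix.isUnit_iff_isUnit_det _).1 hX.isUnit)

end MimoRician
end

/-! ### Schur complements: monotonicity in the two scalar parameters. -/

noncomputable section

namespace MimoRician

variable {m k : ℕ}

/-- The matrix `1 + y R + C (1 + x S)⁻¹ Cᴴ`. -/
def schurMat (R : Matrix (Fin m) (Fin m) ℂ) (S : Matrix (Fin k) (Fin k) ℂ)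
    (C : Matrix (Fin m) (Fin k) ℂ) (x y : ℝ) : Matrix (Fin m) (Fin m) ℂ :=
  1 + (y : ℂ) • R + C * (1 + (x : ℂ) • S)⁻¹ * Cᴴ

/-- The functional `log det (1 + y R) + log det (1 + x S + Cᴴ (1 + y R)⁻¹ C)`. -/
def logDetSum (R : Matrix (Fin m) (Fin m) ℂ) (S : Matrix (Fin k) (Fin k) ℂ)
    (C : Matrix (Fin m) (Fin k) ℂ) (x y : ℝ) : ℝ :=
  logDet (1 + (y : ℂ) • R) + logDet (schurMat S R Cᴴ y x)

variable {R : Matrix (Fin m) (Fin m) ℂ} {S : Matrix (Fin k) (Fin k) ℂ}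
  {C : Matrix (Fin m) (Fin k) ℂ} {x x' y y' : ℝ}

lemma schurMat_posDef (hR : R.PosSemidef) (hS : S.PosSemidef) (C : Matrix (Fin m) (Fin k) ℂ)
    (hx : 0 ≤ x) (hy : 0 ≤ y) : (schurMat R S C x y).PosDef :=
  (posDef_one_add_smul hR hy).add_posSemidef
    ((posDef_one_add_smul hS hx).inv.posSemidef.mul_mul_conjTranspose_same C)

lemma schurMat_add_right (R : Matrix (Fin m) (Fin m) ℂ) (S : Matrix (Fin k) (Fin k) ℂ)
    (C : Matrix (Fin m) (Fin k) ℂ) (x y y' : ℝ) :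
    schurMat R S C x y' = schurMat R S C x y + ((y' - y : ℝ) : ℂ) • R := by
  simp only [schurMat, Complex.ofReal_sub, sub_smul]
  abel

lemma schurMat_mono_right (hR : R.PosSemidef) (S : Matrix (Fin k) (Fin k) ℂ)
    (C : Matrix (Fin m) (Fin k) ℂ) (x : ℝ) (h : y ≤ y') :
    (schurMat R S C x y' - schurMat R S C x y).PosSemidef := by
  rw [schurMat_add_right R S C x y y', add_sub_cancel_left]
  exact posSemidef_ofReal_smul hR (sub_nonneg.2 h)

lemma schurMat_anti_left (R : Matrix (Fin m) (Fin m) ℂ) (hS : S.PosSemidef)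
    (C : Matrix (Fin m) (Fin k) ℂ) (y : ℝ) (hx : 0 ≤ x) (h : x ≤ x') :
    (schurMat R S C x y - schurMat R S C x' y).PosSemidef := by
  have h1 : ((1 + (x' : ℂ) • S) - (1 + (x : ℂ) • S)).PosSemidef := by
    rw [add_sub_add_left_eq_sub, ← sub_smul, ← Complex.ofReal_sub]
    exact posSemidef_ofReal_smul hS (sub_nonneg.2 h)
  have h2 := posSemidef_inv_sub_inv (posDef_one_add_smul hS hx) h1
  have h3 := h2.mul_mul_conjTranspose_same C
  rwa [Matrix.mul_sub, Matrix.sub_mul, ← add_sub_add_left_eq_sub _ _ (1 + (y : ℂ) • R)] at h3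

/-- Monotonicity of `Tr M (1 + y R + C (1 + x S)⁻¹ Cᴴ)⁻¹`. -/
lemma trace_mul_inv_schurMat_le {M : Matrix (Fin m) (Fin m) ℂ} (hM : M.PosSemidef)
    (hR : R.PosSemidef) (hS : S.PosSemidef) (C : Matrix (Fin m) (Fin k) ℂ)
    (hx : 0 ≤ x) (hxx : x ≤ x') (hy' : 0 ≤ y') (hyy : y' ≤ y) :
    (M * (schurMat R S C x y)⁻¹).trace.re ≤ (M * (schurMat R S C x' y')⁻¹).trace.re := by
  have h : (schurMat R S C x y - schurMat R S C x' y').PosSemidef := by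
    have := (schurMat_mono_right hR S C x hyy).add (schurMat_anti_left R hS C y' hx hxx)
    rwa [sub_add_sub_cancel] at this
  have h1 := re_trace_mul_nonneg hM
    (posSemidef_inv_sub_inv (schurMat_posDef hR hS C (hx.trans hxx) hy') h)
  rw [Matrix.mul_sub, Matrix.trace_sub, Complex.sub_re] at h1
  linarith

lemma trace_mul_inv_schurMat_lt (hR : R.PosSemidef) (hR0 : R ≠ 0) (hS : S.PosSemidef)
    (C : Matrix (Fin m) (Fin k) ℂ) (hx : 0 ≤ x) (hy' : 0 ≤ y') (hyy : y' < y) :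
    (R * (schurMat R S C x y)⁻¹).trace.re < (R * (schurMat R S C x y')⁻¹).trace.re := by
  rw [schurMat_add_right R S C x y' y]
  exact trace_mul_inv_strictAnti (schurMat_posDef hR hS C hx hy') hR hR0 (sub_pos.2 hyy)

lemma trace_inv_schurMat_lt (hR : R.PosSemidef) (hR0 : R ≠ 0) (hS : S.PosSemidef)
    (C : Matrix (Fin m) (Fin k) ℂ) (hx : 0 ≤ x) (hy' : 0 ≤ y') (hyy : y' < y) :
    (schurMat R S C x y)⁻¹.trace.re < (schurMat R S C x y')⁻¹.trace.re := by
  refine re_trace_inv_lt (schurMat_posDef hR hS C hx hy') (schurMat_mono_right hR S C x hyy.le) ?_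
  rw [schurMat_add_right R S C x y' y]
  have : ((y - y' : ℝ) : ℂ) ≠ 0 := by exact_mod_cast (sub_pos.2 hyy).ne'
  simpa [hR0] using this

/-- Scalability: `Tr M (1 + y R + C (1 + x S)⁻¹ Cᴴ)⁻¹ / x` is antitone in `x`. -/
lemma mul_trace_mul_inv_schurMat_le {M : Matrix (Fin m) (Fin m) ℂ} (hM : M.PosSemidef)
    (hR : R.PosSemidef) (hS : S.PosSemidef) (C : Matrix (Fin m) (Fin k) ℂ)
    (hx : 0 < x) (hxx : x ≤ x') (hy : 0 ≤ y) :
    x * (M * (schurMat R S C x' y)⁻¹).trace.re ≤ x' * (M * (schurMat R S C x y)⁻¹).trace.re := by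
  have hx' : 0 < x' := hx.trans_le hxx
  -- Dividing by t scales the matrix inside the inverse by t. Since t(1 + tS)⁻¹ = (t⁻¹ + S)⁻¹, every
  -- term of the scaled matrix increases with t, so its inverse decreases.
  have key (t : ℝ) (ht : 0 < t) : (t⁻¹ : ℂ) • (schurMat R S C t y)⁻¹
      = ((t : ℂ) • (1 + (y : ℂ) • R) + C * ((t⁻¹ : ℝ) • 1 + S)⁻¹ * Cᴴ)⁻¹ := by
    have ht' : (t : ℂ) ≠ 0 := by exact_mod_cast ht.ne'
    have e1 : (t⁻¹ : ℝ) • (1 : Matrix (Fin k) (Fin k) ℂ) + S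
        = (t⁻¹ : ℂ) • (1 + (t : ℂ) • S) := by
      rw [smul_add, smul_smul, inv_mul_cancel₀ ht', one_smul, ← Complex.ofReal_inv]
      rfl
    have u1 : IsUnit (1 + (t : ℂ) • S).det :=
      (Matrix.isUnit_iff_isUnit_det _).1 (posDef_one_add_smul hS ht.le).isUnit
    have u2 : IsUnit (schurMat R S C t y).det :=
      (Matrix.isUnit_iff_isUnit_det _).1 (schurMat_posDef hR hS C ht.le hy).isUnit
    have e2 : ((t⁻¹ : ℂ) • (1 + (t : ℂ) • S))⁻¹ = (t : ℂ) • (1 + (t : ℂ) • S)⁻¹ := by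
      refine Matrix.inv_eq_left_inv ?_
      rw [Matrix.smul_mul, Matrix.mul_smul, smul_smul, Matrix.nonsing_inv_mul _ u1,
        mul_inv_cancel₀ ht', one_smul]
    rw [e1, e2, Matrix.mul_smul, Matrix.smul_mul, ← smul_add]
    symm
    refine Matrix.inv_eq_left_inv ?_
    change (t⁻¹ : ℂ) • (schurMat R S C t y)⁻¹ * ((t : ℂ) • schurMat R S C t y) = 1
    rw [Matrix.smul_mul, Matrix.mul_smul, smul_smul, Matrix.nonsing_inv_mul _ u2,
      inv_mul_cancel₀ ht', one_smul]
  have pd (t : ℝ) (ht : 0 < t) : ((t⁻¹ : ℝ) • (1 : Matrix (Fin k) (Fin k) ℂ) + S).PosDef :=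
    (Matrix.PosDef.one.smul (inv_pos.2 ht)).add_posSemidef hS
  have pd2 (t : ℝ) (ht : 0 < t) :
      ((t : ℂ) • (1 + (y : ℂ) • R) + C * ((t⁻¹ : ℝ) • 1 + S)⁻¹ * Cᴴ).PosDef :=
    ((posDef_one_add_smul hR hy).smul (by exact_mod_cast ht)).add_posSemidef
      ((pd t ht).inv.posSemidef.mul_mul_conjTranspose_same C)
  have hle : ((x' : ℂ) • (1 + (y : ℂ) • R) + C * ((x'⁻¹ : ℝ) • 1 + S)⁻¹ * Cᴴ -
      ((x : ℂ) • (1 + (y : ℂ) • R) + C * ((x⁻¹ : ℝ) • 1 + S)⁻¹ * Cᴴ)).PosSemidef := by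
    rw [add_sub_add_comm, ← sub_smul, ← Complex.ofReal_sub, ← Matrix.sub_mul, ← Matrix.mul_sub]
    refine (posSemidef_ofReal_smul (posDef_one_add_smul hR hy).posSemidef (sub_nonneg.2 hxx)).add
      ((posSemidef_inv_sub_inv (pd x' hx') ?_).mul_mul_conjTranspose_same C)
    rw [add_sub_add_right_eq_sub, ← sub_smul]
    exact Matrix.PosSemidef.one.smul (sub_nonneg.2 (inv_anti₀ hx hxx))
  have h := re_trace_mul_nonneg hM (posSemidef_inv_sub_inv (pd2 x hx) hle)
  rw [← key x hx, ← key x' hx', Matrix.mul_sub, Matrix.trace_sub, Complex.sub_re, Matrix.mul_smul,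
    Matrix.mul_smul, Matrix.trace_smul, Matrix.trace_smul, ← Complex.ofReal_inv,
    ← Complex.ofReal_inv, smul_eq_mul, smul_eq_mul, Complex.re_ofReal_mul,
    Complex.re_ofReal_mul] at h
  have h2 := mul_nonneg (mul_pos hx hx').le h
  field_simp at h2
  linarith

/-- `x Tr S d - y Tr R a = k - m + Tr a - Tr d` for the two diagonal blocks `a`, `d` of the
inverse of the block matrix with Schur complements `schurMat`. -/
lemma trace_schurMat_identity (hR : R.PosSemidef) (hS : S.PosSemidef)
    (C : Matrix (Fin m) (Fin k) ℂ) (hx : 0 ≤ x) (hy : 0 ≤ y) :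
    x * (S * (schurMat S R Cᴴ y x)⁻¹).trace.re - y * (R * (schurMat R S C x y)⁻¹).trace.re
      = k - m + (schurMat R S C x y)⁻¹.trace.re - (schurMat S R Cᴴ y x)⁻¹.trace.re := by
  have pρ := posDef_one_add_smul hR hy
  have pτ := posDef_one_add_smul hS hx
  have ud := (Matrix.isUnit_iff_isUnit_det _).1 (schurMat_posDef hS hR Cᴴ hy hx).isUnit
  have uρ := (Matrix.isUnit_iff_isUnit_det _).1 pρ.isUnit
  have uτ := (Matrix.isUnit_iff_isUnit_det _).1 pτ.isUnit
  have ed : (1 + (x : ℂ) • S)⁻¹⁻¹ + Cᴴ * (1 + (y : ℂ) • R)⁻¹ * C = schurMat S R Cᴴ y x := by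
    rw [Matrix.nonsing_inv_nonsing_inv _ uτ, schurMat, Matrix.conjTranspose_conjTranspose]
  -- Woodbury identity, expressing one diagonal block of the inverse through the other.
  have ha : (schurMat R S C x y)⁻¹ = (1 + (y : ℂ) • R)⁻¹ -
      (1 + (y : ℂ) • R)⁻¹ * C * (schurMat S R Cᴴ y x)⁻¹ * Cᴴ * (1 + (y : ℂ) • R)⁻¹ := by
    rw [← ed]
    exact Matrix.add_mul_mul_inv_eq_sub _ _ _ _ pρ.isUnit pτ.inv.isUnit
      (ed ▸ (schurMat_posDef hS hR Cᴴ hy hx).isUnit)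
  have hy1 : y * (R * (schurMat R S C x y)⁻¹).trace.re = m -
      (C * (schurMat S R Cᴴ y x)⁻¹ * Cᴴ * (1 + (y : ℂ) • R)⁻¹).trace.re
        - (schurMat R S C x y)⁻¹.trace.re := by
    have h1 : (y : ℂ) • R * (schurMat R S C x y)⁻¹ =
        1 - C * (schurMat S R Cᴴ y x)⁻¹ * Cᴴ * (1 + (y : ℂ) • R)⁻¹ -
          (schurMat R S C x y)⁻¹ := by
      have h2 : (1 + (y : ℂ) • R) * (schurMat R S C x y)⁻¹ =
          1 - C * (schurMat S R Cᴴ y x)⁻¹ * Cᴴ * (1 + (y : ℂ) • R)⁻¹ := by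
        rw [ha, Matrix.mul_sub, Matrix.mul_nonsing_inv _ uρ]
        simp only [Matrix.mul_assoc]
        rw [Matrix.mul_nonsing_inv_cancel_left _ _ uρ]
      rw [← h2, add_mul, one_mul, add_sub_cancel_left]
    have h3 := congrArg (fun M => M.trace.re) h1
    simpa [Matrix.trace_sub, Matrix.trace_smul] using h3
  have hx1 : x * (S * (schurMat S R Cᴴ y x)⁻¹).trace.re = k -
      (Cᴴ * (1 + (y : ℂ) • R)⁻¹ * C * (schurMat S R Cᴴ y x)⁻¹).trace.re
        - (schurMat S R Cᴴ y x)⁻¹.trace.re := by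
    have h1 : (x : ℂ) • S * (schurMat S R Cᴴ y x)⁻¹ =
        1 - Cᴴ * (1 + (y : ℂ) • R)⁻¹ * C * (schurMat S R Cᴴ y x)⁻¹ -
          (schurMat S R Cᴴ y x)⁻¹ := by
      have h2 : schurMat S R Cᴴ y x * (schurMat S R Cᴴ y x)⁻¹ = 1 :=
        Matrix.mul_nonsing_inv _ ud
      rw [← h2]
      conv_rhs => enter [1, 1, 1]; rw [schurMat, Matrix.conjTranspose_conjTranspose]
      rw [add_mul, add_mul, one_mul]
      abel
    have h3 := congrArg (fun M => M.trace.re) h1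
    simpa [Matrix.trace_sub, Matrix.trace_smul] using h3
  -- The cross terms of the two expansions agree by cyclicity of the trace, so they cancel in the
  -- difference.
  have hc : (C * (schurMat S R Cᴴ y x)⁻¹ * Cᴴ * (1 + (y : ℂ) • R)⁻¹).trace =
      (Cᴴ * (1 + (y : ℂ) • R)⁻¹ * C * (schurMat S R Cᴴ y x)⁻¹).trace := by
    rw [Matrix.mul_assoc _ Cᴴ, Matrix.trace_mul_comm, ← Matrix.mul_assoc]
  rw [hy1, hx1, hc]
  ring

/-- The logarithmic derivative `x Tr S d - y Tr R a` is increasing in `x` and decreasing in `y`. -/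
lemma trace_schurMat_sub_lt (hR : R.PosSemidef) (hS : S.PosSemidef) (hS0 : S ≠ 0)
    (C : Matrix (Fin m) (Fin k) ℂ) (hx : 0 ≤ x) (hxx : x < x') (hy' : 0 ≤ y') (hyy : y' ≤ y) :
    x * (S * (schurMat S R Cᴴ y x)⁻¹).trace.re - y * (R * (schurMat R S C x y)⁻¹).trace.re <
      x' * (S * (schurMat S R Cᴴ y' x')⁻¹).trace.re
        - y' * (R * (schurMat R S C x' y')⁻¹).trace.re := by
  -- The products on the left are not visibly monotone. The identity leaves only Tr a − Tr d, where
  -- Tr a increases in x and decreases in y and Tr d does the opposite; S ≠ 0 makes Tr d strict.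
  rw [trace_schurMat_identity hR hS C hx (hy'.trans hyy),
    trace_schurMat_identity hR hS C (hx.trans hxx.le) hy']
  have h1 := trace_mul_inv_schurMat_le Matrix.PosSemidef.one hR hS C hx hxx.le hy' hyy
  have h2 := trace_mul_inv_schurMat_le Matrix.PosSemidef.one hS hR Cᴴ hy' hyy
    (hx.trans hxx.le) (le_refl x')
  have h3 := trace_inv_schurMat_lt hS hS0 hR Cᴴ (hy'.trans hyy) hx hxx
  rw [one_mul, one_mul] at h1 h2
  linarith

/-! ### Existence and uniqueness for the fixed point system. -/

/-- The fixed point system, in normalized form. -/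
def IsFixedPair (c : ℝ) (R : Matrix (Fin m) (Fin m) ℂ) (S : Matrix (Fin k) (Fin k) ℂ)
    (C : Matrix (Fin m) (Fin k) ℂ) (x y : ℝ) : Prop :=
  0 < x ∧ 0 < y ∧ c * x = (R * (schurMat R S C x y)⁻¹).trace.re ∧
    c * y = (S * (schurMat S R Cᴴ y x)⁻¹).trace.re

lemma IsFixedPair.not_lt {c : ℝ} (hR : R.PosSemidef) (hR0 : R ≠ 0) (hS : S.PosSemidef)
    (hS0 : S ≠ 0) (h : IsFixedPair c R S C x y) (h' : IsFixedPair c R S C x' y') : ¬ x < x' := by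
  intro hlt
  obtain ⟨hx, hy, e1, e2⟩ := h
  obtain ⟨hx', hy', e1', e2'⟩ := h'
  -- At any fixed pair the difference in `trace_schurMat_sub_lt` is x(cy) − y(cx) = 0, so x cannot
  -- increase while y does not.
  have hyy : y < y' := by
    by_contra! hyy
    have := trace_schurMat_sub_lt hR hS hS0 C hx.le hlt hy'.le hyy
    rw [← e1, ← e1', ← e2, ← e2'] at this
    exact absurd this (by ring_nf; exact lt_irrefl _)
  -- Now both coordinates increase. Strict decrease in y and scalability in x give x·cx' < x'·cx,
  -- which is absurd.
  have h1 := trace_mul_inv_schurMat_lt hR hR0 hS C hx'.le hy.le hyy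
  have h2 := mul_trace_mul_inv_schurMat_le hR hR hS C hx hlt.le hy.le
  rw [← e1'] at h1
  rw [← e1] at h2
  nlinarith [mul_lt_mul_of_pos_left h1 hx]

lemma IsFixedPair.symm {c : ℝ} (h : IsFixedPair c R S C x y) : IsFixedPair c S R Cᴴ y x := by
  obtain ⟨hx, hy, e1, e2⟩ := h
  exact ⟨hy, hx, e2, by rwa [Matrix.conjTranspose_conjTranspose]⟩

theorem IsFixedPair.unique {c : ℝ} (hR : R.PosSemidef) (hR0 : R ≠ 0) (hS : S.PosSemidef)
    (hS0 : S ≠ 0) (h : IsFixedPair c R S C x y) (h' : IsFixedPair c R S C x' y') :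
    x = x' ∧ y = y' :=
  ⟨le_antisymm (_root_.not_lt.1 (h'.not_lt hR hR0 hS hS0 h)) (_root_.not_lt.1 (h.not_lt hR hR0 hS hS0 h')),
    le_antisymm (_root_.not_lt.1 (h'.symm.not_lt hS hS0 hR hR0 h.symm))
      (_root_.not_lt.1 (h.symm.not_lt hS hS0 hR hR0 h'.symm))⟩

lemma trace_mul_inv_schurMat_le_trace {M : Matrix (Fin m) (Fin m) ℂ} (hM : M.PosSemidef)
    (hR : R.PosSemidef) (hS : S.PosSemidef) (C : Matrix (Fin m) (Fin k) ℂ)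
    (hx : 0 ≤ x) (hy : 0 ≤ y) :
    (M * (schurMat R S C x y)⁻¹).trace.re ≤ M.trace.re := by
  have h : (schurMat R S C x y - 1).PosSemidef := by
    rw [schurMat, add_assoc, add_sub_cancel_left]
    exact (posSemidef_ofReal_smul hR hy).add
      ((posDef_one_add_smul hS hx).inv.posSemidef.mul_mul_conjTranspose_same C)
  have h1 := re_trace_mul_nonneg hM (posSemidef_inv_sub_inv Matrix.PosDef.one h)
  rw [Matrix.mul_sub, Matrix.trace_sub, Complex.sub_re, inv_one, mul_one] at h1
  linarith

/-- Existence of a solution, by the Knaster–Tarski fixed point theorem: the map is monotone for the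
order that is reversed in the second coordinate. -/
theorem exists_isFixedPair {c : ℝ} (hc : 0 < c) (hR : R.PosSemidef) (hR0 : R ≠ 0)
    (hS : S.PosSemidef) (hS0 : S ≠ 0) (C : Matrix (Fin m) (Fin k) ℂ) :
    ∃ x y, IsFixedPair c R S C x y := by
  have hX : 0 ≤ R.trace.re / c := div_nonneg (re_trace_nonneg hR) hc.le
  have hY : 0 ≤ S.trace.re / c := div_nonneg (re_trace_nonneg hS) hc.le
  -- Nonemptiness of the intervals, as an instance, makes them complete lattices; their upper ends
  -- come from `trace_mul_inv_schurMat_le_trace`.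
  have := Fact.mk hX
  have := Fact.mk hY
  let g : Set.Icc 0 (R.trace.re / c) × (Set.Icc 0 (S.trace.re / c))ᵒᵈ →o
      Set.Icc 0 (R.trace.re / c) × (Set.Icc 0 (S.trace.re / c))ᵒᵈ :=
    { toFun := fun q =>
        (⟨(R * (schurMat R S C q.1 (OrderDual.ofDual q.2 : Set.Icc 0 (S.trace.re / c)))⁻¹).trace.re
            / c, div_nonneg (re_trace_mul_nonneg hR (schurMat_posDef hR hS C q.1.2.1
              (OrderDual.ofDual q.2).2.1).inv.posSemidef) hc.le,
            div_le_div_of_nonneg_right (trace_mul_inv_schurMat_le_trace hR hR hS C q.1.2.1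
              (OrderDual.ofDual q.2).2.1) hc.le⟩,
          OrderDual.toDual
          ⟨(S * (schurMat S R Cᴴ (OrderDual.ofDual q.2 : Set.Icc 0 (S.trace.re / c)) q.1)⁻¹).trace.re
            / c, div_nonneg (re_trace_mul_nonneg hS (schurMat_posDef hS hR Cᴴ
              (OrderDual.ofDual q.2).2.1 q.1.2.1).inv.posSemidef) hc.le,
            div_le_div_of_nonneg_right (trace_mul_inv_schurMat_le_trace hS hS hR Cᴴ
              (OrderDual.ofDual q.2).2.1 q.1.2.1) hc.le⟩)
      monotone' := fun q q' h => ⟨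
        div_le_div_of_nonneg_right (trace_mul_inv_schurMat_le hR hR hS C q.1.2.1 h.1
          (OrderDual.ofDual q'.2).2.1 h.2) hc.le,
        div_le_div_of_nonneg_right (trace_mul_inv_schurMat_le hS hS hR Cᴴ
          (OrderDual.ofDual q'.2).2.1 h.2 q.1.2.1 h.1) hc.le⟩ }
  have hfix := g.map_lfp
  set q := g.lfp
  have hx0 := q.1.2.1
  have hy0 := (OrderDual.ofDual q.2).2.1
  have e1 : (R * (schurMat R S C q.1 (OrderDual.ofDual q.2 : Set.Icc 0 (S.trace.re / c)))⁻¹).trace.re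
      / c = q.1 := congrArg (fun q => (q.1 : ℝ)) hfix
  have e2 : (S * (schurMat S R Cᴴ (OrderDual.ofDual q.2 : Set.Icc 0 (S.trace.re / c))
      q.1)⁻¹).trace.re / c = (OrderDual.ofDual q.2 : Set.Icc 0 (S.trace.re / c)) :=
    congrArg (fun r : Set.Icc 0 (R.trace.re / c) × (Set.Icc 0 (S.trace.re / c))ᵒᵈ =>
      ((OrderDual.ofDual r.2 : Set.Icc 0 (S.trace.re / c)) : ℝ)) hfix
  -- The lattice includes zero coordinates, but the map takes strictly positive values even there,
  -- so its fixed point is strictly positive.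
  have p1 := div_pos (trace_mul_inv_pos (schurMat_posDef hR hS C hx0 hy0) hR hR0) hc
  have p2 := div_pos (trace_mul_inv_pos (schurMat_posDef hS hR Cᴴ hy0 hx0) hS hS0) hc
  exact ⟨q.1, (OrderDual.ofDual q.2 : Set.Icc 0 (S.trace.re / c)), p1.trans_eq e1, p2.trans_eq e2,
    (mul_comm _ _).trans ((div_eq_iff hc.ne').1 e1).symm,
    (mul_comm _ _).trans ((div_eq_iff hc.ne').1 e2).symm⟩

end MimoRician
end

/-! ### The log-determinant functional: separate concavity, and convexity along hyperbolas. -/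

noncomputable section

namespace MimoRician

variable {m k : ℕ} {R : Matrix (Fin m) (Fin m) ℂ} {S : Matrix (Fin k) (Fin k) ℂ}
  {C : Matrix (Fin m) (Fin k) ℂ} {x x' y y' : ℝ}

/-- A block matrix, affine in `x` and `y`, whose log-determinant is `logDetSum`. -/
def linearization (R : Matrix (Fin m) (Fin m) ℂ) (S : Matrix (Fin k) (Fin k) ℂ)
    (C : Matrix (Fin m) (Fin k) ℂ) (x y : ℝ) : Matrix (Fin m ⊕ Fin k) (Fin m ⊕ Fin k) ℂ :=
  Matrix.fromBlocks (1 + (y : ℂ) • R) (-C) Cᴴ (1 + (x : ℂ) • S)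

/-- The opposite signs of the off-diagonal blocks turn the minus of the Schur complement formula
into the plus of `schurMat`. -/
lemma det_linearization₁ (hR : R.PosSemidef) (S : Matrix (Fin k) (Fin k) ℂ)
    (C : Matrix (Fin m) (Fin k) ℂ) (x : ℝ) (hy : 0 ≤ y) :
    (linearization R S C x y).det = (1 + (y : ℂ) • R).det * (schurMat S R Cᴴ y x).det := by
  obtain ⟨_⟩ := (posDef_one_add_smul hR hy).isUnit.nonempty_invertible
  rw [linearization, Matrix.det_fromBlocks₁₁, Matrix.invOf_eq_nonsing_inv, Matrix.mul_neg,
    sub_neg_eq_add, schurMat, Matrix.conjTranspose_conjTranspose]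

lemma det_linearization₂ (R : Matrix (Fin m) (Fin m) ℂ) (hS : S.PosSemidef)
    (C : Matrix (Fin m) (Fin k) ℂ) (hx : 0 ≤ x) (y : ℝ) :
    (linearization R S C x y).det = (1 + (x : ℂ) • S).det * (schurMat R S C x y).det := by
  obtain ⟨_⟩ := (posDef_one_add_smul hS hx).isUnit.nonempty_invertible
  rw [linearization, Matrix.det_fromBlocks₂₂, Matrix.invOf_eq_nonsing_inv, Matrix.neg_mul,
    Matrix.neg_mul, sub_neg_eq_add, schurMat]

lemma log_re_det_mul {X : Matrix (Fin m) (Fin m) ℂ} {Y : Matrix (Fin k) (Fin k) ℂ}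
    (hX : X.PosDef) (hY : Y.PosDef) :
    0 < (X.det * Y.det).re ∧ Real.log (X.det * Y.det).re = logDet X + logDet Y := by
  rw [← ofReal_re_det hX, ← ofReal_re_det hY, ← Complex.ofReal_mul, Complex.ofReal_re, logDet,
    logDet, Real.log_mul (re_det_pos hX).ne' (re_det_pos hY).ne']
  exact ⟨mul_pos (re_det_pos hX) (re_det_pos hY), rfl⟩

lemma log_det_linearization (hR : R.PosSemidef) (hS : S.PosSemidef)
    (C : Matrix (Fin m) (Fin k) ℂ) (hx : 0 ≤ x) (hy : 0 ≤ y) :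
    0 < (linearization R S C x y).det.re ∧
      Real.log (linearization R S C x y).det.re = logDetSum R S C x y := by
  rw [det_linearization₁ hR S C x hy]
  exact log_re_det_mul (posDef_one_add_smul hR hy) (schurMat_posDef hS hR Cᴴ hy hx)

/-- Both Schur complements factor the determinant of `linearization`. This symmetry carries every
statement about x over to y. -/
lemma logDetSum_symm (hR : R.PosSemidef) (hS : S.PosSemidef)
    (C : Matrix (Fin m) (Fin k) ℂ) (hx : 0 ≤ x) (hy : 0 ≤ y) :
    logDetSum R S C x y = logDetSum S R Cᴴ y x := by
  rw [← (log_det_linearization hR hS C hx hy).2, det_linearization₂ R hS C hx y,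
    (log_re_det_mul (posDef_one_add_smul hS hx) (schurMat_posDef hR hS C hx hy)).2, logDetSum,
    Matrix.conjTranspose_conjTranspose]

/-- `logDetSum` is concave in its first argument. -/
lemma logDetSum_le_left (hR : R.PosSemidef) (hS : S.PosSemidef)
    (C : Matrix (Fin m) (Fin k) ℂ) (hx : 0 ≤ x) (hx' : 0 ≤ x') (hy : 0 ≤ y) :
    logDetSum R S C x' y ≤ logDetSum R S C x y +
      (x' - x) * (S * (schurMat S R Cᴴ y x)⁻¹).trace.re := by
  have h := logDet_le_add_trace (schurMat_posDef hS hR Cᴴ hy hx) (schurMat_posDef hS hR Cᴴ hy hx')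
  have e : schurMat S R Cᴴ y x' - schurMat S R Cᴴ y x = ((x' - x : ℝ) : ℂ) • S := by
    rw [schurMat_add_right S R Cᴴ y x x', add_sub_cancel_left]
  rw [e, Matrix.mul_smul, Matrix.trace_smul, smul_eq_mul, Complex.re_ofReal_mul,
    Matrix.trace_mul_comm] at h
  simp only [logDetSum]
  linarith

/-- `logDetSum` is concave in its second argument. -/
lemma logDetSum_le_right (hR : R.PosSemidef) (hS : S.PosSemidef)
    (C : Matrix (Fin m) (Fin k) ℂ) (hx : 0 ≤ x) (hy : 0 ≤ y) (hy' : 0 ≤ y') :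
    logDetSum R S C x y' ≤ logDetSum R S C x y +
      (y' - y) * (R * (schurMat R S C x y)⁻¹).trace.re := by
  have h := logDetSum_le_left hS hR Cᴴ hy hy' hx
  rwa [logDetSum_symm hR hS C hx hy, logDetSum_symm hR hS C hx hy',
    ← Matrix.conjTranspose_conjTranspose C, Matrix.conjTranspose_conjTranspose Cᴴ]

/-- The Leibniz expansion is a polynomial in entries affine in the parameters. This supplies joint
differentiability without differentiating an inverse. -/
lemma differentiable_det_linearization (R : Matrix (Fin m) (Fin m) ℂ)
    (S : Matrix (Fin k) (Fin k) ℂ) (C : Matrix (Fin m) (Fin k) ℂ) :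
    Differentiable ℝ fun q : ℝ × ℝ => (linearization R S C q.1 q.2).det.re := by
  refine Complex.reCLM.differentiable.comp ?_
  simp only [Matrix.det_apply]
  refine Differentiable.fun_sum fun σ _ => Differentiable.const_smul ?_ _
  refine (contDiff_prod fun i _ => ?_ : ContDiff ℝ 1 _).differentiable one_ne_zero
  have h1 : ContDiff ℝ 1 fun q : ℝ × ℝ => (q.1 : ℂ) := Complex.ofRealCLM.contDiff.comp contDiff_fst
  have h2 : ContDiff ℝ 1 fun q : ℝ × ℝ => (q.2 : ℂ) := Complex.ofRealCLM.contDiff.comp contDiff_snd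
  rcases h : σ i with a | a <;> rcases i with b | b <;>
    simp only [linearization, Matrix.fromBlocks_apply₁₁, Matrix.fromBlocks_apply₁₂,
      Matrix.fromBlocks_apply₂₁, Matrix.fromBlocks_apply₂₂, Matrix.add_apply, Matrix.smul_apply,
      smul_eq_mul] <;>
    fun_prop

/-- The derivative of `logDetSum` along the curve `x y = p`. -/
lemma hasDerivAt_logDetSum_exp (hR : R.PosSemidef) (hS : S.PosSemidef)
    (C : Matrix (Fin m) (Fin k) ℂ) {p : ℝ} (hp : 0 < p) (u : ℝ) :
    HasDerivAt (fun u => logDetSum R S C (Real.exp u) (p * Real.exp (-u)))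
      (Real.exp u * (S * (schurMat S R Cᴴ (p * Real.exp (-u)) (Real.exp u))⁻¹).trace.re -
        p * Real.exp (-u) *
          (R * (schurMat R S C (Real.exp u) (p * Real.exp (-u)))⁻¹).trace.re) u := by
  set x := Real.exp u with hx
  set y := p * Real.exp (-u) with hy
  have hx0 : 0 < x := Real.exp_pos u
  have hy0 : 0 < y := mul_pos hp (Real.exp_pos _)
  set F : ℝ × ℝ → ℝ := fun q => Real.log (linearization R S C q.1 q.2).det.re with hF
  have hFeq {x y : ℝ} (hx : 0 ≤ x) (hy : 0 ≤ y) : F (x, y) = logDetSum R S C x y :=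
    (log_det_linearization hR hS C hx hy).2
  have hFd : DifferentiableAt ℝ F (x, y) :=
    ((differentiable_det_linearization R S C).differentiableAt).log
      (log_det_linearization hR hS C hx0.le hy0.le).1.ne'
  obtain ⟨L, hL⟩ := hFd
  have comp {γ : ℝ → ℝ × ℝ} {γ' : ℝ × ℝ} {t : ℝ} (hγ : HasDerivAt γ γ' t) (ht : γ t = (x, y)) :
      HasDerivAt (F ∘ γ) (L γ') t :=
    HasFDerivAt.comp_hasDerivAt t (ht ▸ hL) hγ
  -- The tangent inequality says that the function minus its candidate tangent line has a local
  -- maximum at the base point; its derivative there vanishes, which identifies the partial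
  -- derivative.
  have hL1 : L (1, 0) = (S * (schurMat S R Cᴴ y x)⁻¹).trace.re := by
    have h1 := comp (γ := fun t => (t, y)) ((hasDerivAt_id x).prodMk (hasDerivAt_const x y)) rfl
    have h2 := h1.sub (((hasDerivAt_id x).sub_const x).mul_const
      (S * (schurMat S R Cᴴ y x)⁻¹).trace.re)
    have h3 := IsLocalMax.hasDerivAt_eq_zero ?_ h2
    · linarith
    · filter_upwards [lt_mem_nhds hx0] with t ht
      have := logDetSum_le_left hR hS C hx0.le ht.le hy0.le
      simp only [Pi.sub_apply, Function.comp, id, hFeq hx0.le hy0.le, hFeq ht.le hy0.le]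
      linarith
  have hL2 : L (0, 1) = (R * (schurMat R S C x y)⁻¹).trace.re := by
    have h1 := comp (γ := fun t => (x, t)) ((hasDerivAt_const y x).prodMk (hasDerivAt_id y)) rfl
    have h2 := h1.sub (((hasDerivAt_id y).sub_const y).mul_const
      (R * (schurMat R S C x y)⁻¹).trace.re)
    have h3 := IsLocalMax.hasDerivAt_eq_zero ?_ h2
    · linarith
    · filter_upwards [lt_mem_nhds hy0] with t ht
      have := logDetSum_le_right hR hS C hx0.le hy0.le ht.le
      simp only [Pi.sub_apply, Function.comp, id, hFeq hx0.le hy0.le, hFeq hx0.le ht.le]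
      linarith
  have hd2 : HasDerivAt (fun u => p * Real.exp (-u)) (-y) u := by
    have := ((hasDerivAt_neg u).exp).const_mul p
    rwa [show p * (Real.exp (-u) * -1) = -y by rw [hy]; ring] at this
  have h := comp (γ := fun t => (Real.exp t, p * Real.exp (-t)))
    ((Real.hasDerivAt_exp u).prodMk hd2) rfl
  have hLv : L (Real.exp u, -y) = x * (S * (schurMat S R Cᴴ y x)⁻¹).trace.re -
      y * (R * (schurMat R S C x y)⁻¹).trace.re := by
    rw [← hL1, ← hL2, show (Real.exp u, -y) = x • ((1 : ℝ), (0 : ℝ)) + (-y) • ((0 : ℝ), (1 : ℝ)) by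
      simp [hx], map_add, map_smul, map_smul, smul_eq_mul, smul_eq_mul]
    ring
  rw [hLv] at h
  refine h.congr_of_eventuallyEq (Filter.Eventually.of_forall fun t => ?_)
  exact (hFeq (Real.exp_pos t).le (mul_pos hp (Real.exp_pos _)).le).symm

/-- As u grows, x = eᵘ increases and y = pe⁻ᵘ decreases, so `trace_schurMat_sub_lt` says that the
derivative is strictly increasing. -/
lemma strictConvexOn_logDetSum_exp (hR : R.PosSemidef) (hS : S.PosSemidef) (hS0 : S ≠ 0)
    (C : Matrix (Fin m) (Fin k) ℂ) {p : ℝ} (hp : 0 < p) :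
    StrictConvexOn ℝ Set.univ
      fun u => logDetSum R S C (Real.exp u) (p * Real.exp (-u)) := by
  have hd := hasDerivAt_logDetSum_exp hR hS C hp
  refine StrictMono.strictConvexOn_univ_of_deriv
    (continuous_iff_continuousAt.2 fun u => (hd u).continuousAt) fun u v huv => ?_
  rw [(hd u).deriv, (hd v).deriv]
  refine trace_schurMat_sub_lt hR hS hS0 C (Real.exp_pos u).le (Real.exp_lt_exp.2 huv)
    (mul_pos hp (Real.exp_pos _)).le ?_
  gcongr

end MimoRician
end

/-! ### Translation of the channel model into the normalized system. -/

noncomputable section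

namespace MimoRician

variable {N n : ℕ} {σ : ℝ} {R : Matrix (Fin N) (Fin N) ℂ} {T Q Q' : Matrix (Fin n) (Fin n) ℂ}
  {x y : ℝ}

/-- The normalized matrix `σ⁻¹ A Q^{1/2}`. -/
def scaledMean (σ : ℝ) (A : Matrix (Fin N) (Fin n) ℂ) (Q : Matrix (Fin n) (Fin n) ℂ) :
    Matrix (Fin N) (Fin n) ℂ :=
  ((σ⁻¹ : ℝ) : ℂ) • (A * msqrt Q)

lemma scaledMean_conjTranspose (σ : ℝ) (A : Matrix (Fin N) (Fin n) ℂ)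
    (Q : Matrix (Fin n) (Fin n) ℂ) :
    (scaledMean σ A Q)ᴴ = ((σ⁻¹ : ℝ) : ℂ) • (msqrt Q * Aᴴ) := by
  rw [scaledMean, Matrix.conjTranspose_smul, Matrix.conjTranspose_mul, msqrt_conjTranspose]
  simp

lemma card_pos_of_mem_C1 (hQ : Q ∈ C1 n) : 0 < n := by
  rcases Nat.eq_zero_or_pos n with rfl | h
  · simp [C1] at hQ
  · exact h

lemma ne_zero_of_mem_C1 (hQ : Q ∈ C1 n) : Q ≠ 0 := by
  rintro rfl
  simp [C1] at hQ

lemma convex_mem_C1 {t : ℝ} (hQ : Q ∈ C1 n) (hQ' : Q' ∈ C1 n) (ht0 : 0 ≤ t) (ht1 : t ≤ 1) :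
    ((1 - t : ℝ) : ℂ) • Q + (t : ℂ) • Q' ∈ C1 n := by
  refine ⟨(posSemidef_ofReal_smul hQ.1 (sub_nonneg.2 ht1)).add (posSemidef_ofReal_smul hQ'.1 ht0),
    ?_⟩
  rw [Matrix.trace_add, Matrix.trace_smul, Matrix.trace_smul, smul_eq_mul, smul_eq_mul, mul_add,
    mul_left_comm, mul_left_comm (1 / (n : ℂ)) (t : ℂ), hQ.2, hQ'.2]
  push_cast
  ring

lemma TQ_posSemidef (hT : T.PosSemidef) (Q : Matrix (Fin n) (Fin n) ℂ) : (TQ T Q).PosSemidef := by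
  have := hT.mul_mul_conjTranspose_same (msqrt Q)
  rwa [msqrt_conjTranspose] at this

lemma TQ_ne_zero (hT : T.PosDef) (hQ : Q.PosSemidef) (hQ0 : Q ≠ 0) : TQ T Q ≠ 0 := by
  intro h
  -- Taking X = T⁻¹ gives Tr QT > 0, and this trace equals Tr T(Q).
  have h1 := trace_mul_inv_pos hT.inv hQ hQ0
  rw [Matrix.nonsing_inv_nonsing_inv _ ((Matrix.isUnit_iff_isUnit_det _).1 hT.isUnit),
    ← msqrt_mul_self hQ, Matrix.mul_assoc, Matrix.trace_mul_comm] at h1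
  rw [TQ] at h
  rw [h, Matrix.trace_zero] at h1
  exact lt_irrefl _ h1

lemma trace_mul_inv_smul {m : ℕ} (M X : Matrix (Fin m) (Fin m) ℂ) {s : ℝ} (hs : 0 < s)
    (hX : X.PosDef) :
    s * (M * ((s : ℂ) • X)⁻¹).trace.re = (M * X⁻¹).trace.re := by
  have hs' : (s : ℂ) ≠ 0 := by exact_mod_cast hs.ne'
  have e : ((s : ℂ) • X)⁻¹ = ((s⁻¹ : ℝ) : ℂ) • X⁻¹ := by
    refine Matrix.inv_eq_left_inv ?_
    rw [Matrix.smul_mul, Matrix.mul_smul, smul_smul,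
      Matrix.nonsing_inv_mul _ ((Matrix.isUnit_iff_isUnit_det _).1 hX.isUnit), Complex.ofReal_inv,
      inv_mul_cancel₀ hs', one_smul]
  rw [e, Matrix.mul_smul, Matrix.trace_smul, smul_eq_mul, Complex.re_ofReal_mul,
    mul_inv_cancel_left₀ hs.ne']

/-- Pulling σ² out of the inverse and absorbing σ⁻¹ into A leaves the normalized system with
constant c = σ²n. -/
lemma mul_f_eq (hσ : 0 < σ) (hn : 0 < n) (A : Matrix (Fin N) (Fin n) ℂ) (hR : R.PosSemidef)
    (hT : T.PosSemidef) (Q : Matrix (Fin n) (Fin n) ℂ) (hx : 0 ≤ x) (hy : 0 ≤ y) :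
    σ ^ 2 * n * f σ A R T x y Q =
      (R * (schurMat R (TQ T Q) (scaledMean σ A Q) x y)⁻¹).trace.re := by
  have hn' : (n : ℝ) ≠ 0 := by exact_mod_cast hn.ne'
  have hσ' : (σ : ℂ) ≠ 0 := by exact_mod_cast hσ.ne'
  have hs : ((σ ^ 2 : ℝ) : ℂ) * (((σ⁻¹ : ℝ) : ℂ) * ((σ⁻¹ : ℝ) : ℂ)) = 1 := by
    push_cast
    field_simp
  have e : (((σ ^ 2 : ℝ) : ℂ) • (1 + (y : ℂ) • R) +
      A * msqrt Q * (1 + (x : ℂ) • TQ T Q)⁻¹ * msqrt Q * Aᴴ) =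
      ((σ ^ 2 : ℝ) : ℂ) • schurMat R (TQ T Q) (scaledMean σ A Q) x y := by
    rw [schurMat, scaledMean_conjTranspose, scaledMean, Matrix.mul_smul, Matrix.smul_mul,
      Matrix.smul_mul, smul_smul, ← Matrix.mul_assoc]
    simp only [smul_add, smul_smul, hs, one_smul]
  rw [f, e, ← trace_mul_inv_smul R _ (pow_pos hσ 2)
    (schurMat_posDef hR (TQ_posSemidef hT Q) (scaledMean σ A Q) hx hy)]
  field_simp

lemma mul_f'_eq (hσ : 0 < σ) (hn : 0 < n) (A : Matrix (Fin N) (Fin n) ℂ) (hR : R.PosSemidef)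
    (hT : T.PosSemidef) (Q : Matrix (Fin n) (Fin n) ℂ) (hx : 0 ≤ x) (hy : 0 ≤ y) :
    σ ^ 2 * n * f' σ A R T x y Q =
      (TQ T Q * (schurMat (TQ T Q) R (scaledMean σ A Q)ᴴ y x)⁻¹).trace.re := by
  have hn' : (n : ℝ) ≠ 0 := by exact_mod_cast hn.ne'
  have hσ' : (σ : ℂ) ≠ 0 := by exact_mod_cast hσ.ne'
  have hs : ((σ ^ 2 : ℝ) : ℂ) * (((σ⁻¹ : ℝ) : ℂ) * ((σ⁻¹ : ℝ) : ℂ)) = 1 := by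
    push_cast
    field_simp
  have e : (((σ ^ 2 : ℝ) : ℂ) • (1 + (x : ℂ) • TQ T Q) +
      msqrt Q * Aᴴ * (1 + (y : ℂ) • R)⁻¹ * A * msqrt Q) =
      ((σ ^ 2 : ℝ) : ℂ) • schurMat (TQ T Q) R (scaledMean σ A Q)ᴴ y x := by
    rw [schurMat, Matrix.conjTranspose_conjTranspose, scaledMean_conjTranspose, scaledMean,
      Matrix.mul_smul, Matrix.smul_mul, Matrix.smul_mul, smul_smul, ← Matrix.mul_assoc]
    simp only [smul_add, smul_smul, hs, one_smul]
  rw [f', e, ← trace_mul_inv_smul (TQ T Q) _ (pow_pos hσ 2)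
    (schurMat_posDef (TQ_posSemidef hT Q) hR (scaledMean σ A Q)ᴴ hy hx)]
  field_simp

lemma isCanonicalSolution_iff (hσ : 0 < σ) (hn : 0 < n) (A : Matrix (Fin N) (Fin n) ℂ)
    (hR : R.PosSemidef) (hT : T.PosSemidef) (p : ℝ × ℝ) :
    IsCanonicalSolution σ A R T Q p ↔
      IsFixedPair (σ ^ 2 * n) R (TQ T Q) (scaledMean σ A Q) p.1 p.2 := by
  have hc : σ ^ 2 * (n : ℝ) ≠ 0 := by positivity
  refine and_congr_right fun h1 => and_congr_right fun h2 => ?_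
  rw [← mul_f_eq hσ hn A hR hT Q h1.le h2.le, ← mul_f'_eq hσ hn A hR hT Q h1.le h2.le,
    mul_right_inj' hc, mul_right_inj' hc]

theorem existsUnique_canonicalSolution (hσ : 0 < σ) (A : Matrix (Fin N) (Fin n) ℂ)
    (hR : R.PosSemidef) (hR0 : R ≠ 0) (hT : T.PosDef) (hQ : Q ∈ C1 n) :
    IsCanonicalSolution σ A R T Q (delta σ A R T Q, delta' σ A R T Q) ∧
      ∀ p, IsCanonicalSolution σ A R T Q p → p = (delta σ A R T Q, delta' σ A R T Q) := by
  have hn := card_pos_of_mem_C1 hQ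
  have hS := TQ_posSemidef hT.posSemidef Q
  have hS0 := TQ_ne_zero hT hQ.1 (ne_zero_of_mem_C1 hQ)
  have hiff := isCanonicalSolution_iff (Q := Q) hσ hn A hR hT.posSemidef
  have hex : ∃ p, IsCanonicalSolution σ A R T Q p := by
    obtain ⟨x, y, h⟩ := exists_isFixedPair (c := σ ^ 2 * n) (by positivity) hR hR0 hS hS0
      (scaledMean σ A Q)
    exact ⟨(x, y), (hiff _).2 h⟩
  have h0 : IsCanonicalSolution σ A R T Q (delta σ A R T Q, delta' σ A R T Q) := by
    have h1 : canonicalSolution σ A R T Q = hex.choose := dif_pos hex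
    rw [delta, delta', h1]
    exact hex.choose_spec
  refine ⟨h0, fun p hp => ?_⟩
  have h2 := ((hiff _).1 hp).unique hR hR0 hS hS0 ((hiff _).1 h0)
  exact Prod.ext h2.1 h2.2

lemma G_sq_posDef (hσ : 0 < σ) (A : Matrix (Fin N) (Fin n) ℂ) (hR : R.PosSemidef)
    (hT : T.PosDef) (hx : 0 < x) (hy : 0 ≤ y) :
    ((x : ℂ) • T +
      ((1 / σ ^ 2 : ℝ) : ℂ) • (Aᴴ * (1 + (y : ℂ) • R)⁻¹ * A)).PosDef :=
  (hT.smul (by exact_mod_cast hx)).add_posSemidef (posSemidef_ofReal_smul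
    ((posDef_one_add_smul hR hy).inv.posSemidef.conjTranspose_mul_mul_same A) (by positivity))

/-- Sylvester's identity turns det(1 + GQG) into det(1 + Q^{1/2}G²Q^{1/2}). The left side shows the
concavity in Q, the right side the dependence on x and y. -/
lemma waterfilling_add_logDet (hσ : 0 < σ) (A : Matrix (Fin N) (Fin n) ℂ) (hR : R.PosSemidef)
    (hT : T.PosDef) (hQ : Q.PosSemidef) (hx : 0 < x) (hy : 0 ≤ y) :
    waterfilling σ A R T x y Q + logDet (1 + (y : ℂ) • R) =
      logDetSum R (TQ T Q) (scaledMean σ A Q) x y := by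
  have e : (1 + G σ A R T x y * Q * G σ A R T x y).det =
      (schurMat (TQ T Q) R (scaledMean σ A Q)ᴴ y x).det := by
    have e1 : G σ A R T x y * Q * G σ A R T x y =
        (G σ A R T x y * msqrt Q) * (msqrt Q * G σ A R T x y) := by
      conv_lhs => rw [← msqrt_mul_self hQ]
      simp only [Matrix.mul_assoc]
    rw [e1, Matrix.det_one_add_mul_comm,
      Matrix.mul_assoc, ← Matrix.mul_assoc (G σ A R T x y), G,
      msqrt_mul_self (G_sq_posDef hσ A hR hT hx hy).posSemidef,
      schurMat, Matrix.conjTranspose_conjTranspose, scaledMean_conjTranspose, scaledMean, TQ]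
    congr 1
    simp only [Matrix.add_mul, Matrix.mul_add, Matrix.mul_smul, Matrix.smul_mul, smul_smul,
      Matrix.mul_assoc, add_assoc, one_div, ← Complex.ofReal_mul, sq, mul_inv]
  rw [waterfilling, logDetSum, logDet, e, add_comm]
  rfl

lemma Ibar_eq (hσ : 0 < σ) (A : Matrix (Fin N) (Fin n) ℂ) (hR : R.PosSemidef) (hR0 : R ≠ 0)
    (hT : T.PosDef) (hQ : Q ∈ C1 n) :
    Ibar σ A R T Q =
      logDetSum R (TQ T Q) (scaledMean σ A Q) (delta σ A R T Q) (delta' σ A R T Q) -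
        σ ^ 2 * n * delta σ A R T Q * delta' σ A R T Q := by
  obtain ⟨h1, h2, -⟩ := (existsUnique_canonicalSolution hσ A hR hR0 hT hQ).1
  rw [← waterfilling_add_logDet hσ A hR hT hQ.1 h1 h2.le]
  rfl

/-! ### Concavity of the water-filling objective. -/

lemma one_add_G_mul_posDef (σ : ℝ) (A : Matrix (Fin N) (Fin n) ℂ) (R : Matrix (Fin N) (Fin N) ℂ)
    (T : Matrix (Fin n) (Fin n) ℂ) (x y : ℝ) (hQ : Q.PosSemidef) :
    (1 + G σ A R T x y * Q * G σ A R T x y).PosDef := by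
  have := hQ.mul_mul_conjTranspose_same (G σ A R T x y)
  rw [G, msqrt_conjTranspose, ← G] at this
  exact Matrix.PosDef.one.add_posSemidef this

/-- Concavity of `log det` on positive definite matrices. -/
lemma logDet_concave {m : ℕ} {X Y : Matrix (Fin m) (Fin m) ℂ} (hX : X.PosDef) (hY : Y.PosDef)
    {t : ℝ} (ht0 : 0 ≤ t) (ht1 : t ≤ 1) :
    (1 - t) * logDet X + t * logDet Y ≤ logDet (((1 - t : ℝ) : ℂ) • X + (t : ℂ) • Y) ∧
      (0 < t → t < 1 → X ≠ Y →
        (1 - t) * logDet X + t * logDet Y < logDet (((1 - t : ℝ) : ℂ) • X + (t : ℂ) • Y)) := by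
  set Z := ((1 - t : ℝ) : ℂ) • X + (t : ℂ) • Y with hZdef
  have hZ : Z.PosDef := by
    rcases ht0.eq_or_lt with rfl | ht
    · simpa [hZdef] using hX
    · exact (hY.smul (by exact_mod_cast ht)).posSemidef_add
        (posSemidef_ofReal_smul hX.posSemidef (sub_nonneg.2 ht1))
  -- In the tangent inequalities at Z, the first-order terms at X and Y cancel under the weights 1 −
  -- t and t.
  have eX : X - Z = ((-t : ℝ) : ℂ) • (Y - X) := by
    rw [hZdef]; push_cast; module
  have eY : Y - Z = ((1 - t : ℝ) : ℂ) • (Y - X) := by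
    rw [hZdef]; push_cast; module
  have hX1 := logDet_le_add_trace hZ hX
  have hY1 := logDet_le_add_trace hZ hY
  have hX2 := logDet_lt_add_trace hZ hX
  simp only [eX, eY, Matrix.mul_smul, Matrix.trace_smul, smul_eq_mul, Complex.re_ofReal_mul]
    at hX1 hY1 hX2
  refine ⟨by nlinarith, fun h0 h1 hne => ?_⟩
  have hne' : X ≠ Z := by
    intro h
    rw [← sub_eq_zero, eX, smul_eq_zero, sub_eq_zero] at h
    rcases h with h | h
    · norm_cast at h; linarith
    · exact hne h.symm
  nlinarith [mul_lt_mul_of_pos_left (hX2 hne') (sub_pos.2 h1)]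

lemma one_add_G_mul_combo (σ : ℝ) (A : Matrix (Fin N) (Fin n) ℂ) (R : Matrix (Fin N) (Fin N) ℂ)
    (T : Matrix (Fin n) (Fin n) ℂ) (x y t : ℝ) (Q Q' : Matrix (Fin n) (Fin n) ℂ) :
    1 + G σ A R T x y * (((1 - t : ℝ) : ℂ) • Q + (t : ℂ) • Q') * G σ A R T x y =
      ((1 - t : ℝ) : ℂ) • (1 + G σ A R T x y * Q * G σ A R T x y) +
        (t : ℂ) • (1 + G σ A R T x y * Q' * G σ A R T x y) := by
  simp only [Matrix.mul_add, Matrix.add_mul, Matrix.mul_smul, Matrix.smul_mul]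
  push_cast
  module

lemma waterfilling_concave (σ : ℝ) (A : Matrix (Fin N) (Fin n) ℂ) (R : Matrix (Fin N) (Fin N) ℂ)
    (T : Matrix (Fin n) (Fin n) ℂ) (x y : ℝ) (hQ : Q.PosSemidef) (hQ' : Q'.PosSemidef)
    {t : ℝ} (ht0 : 0 ≤ t) (ht1 : t ≤ 1) :
    (1 - t) * waterfilling σ A R T x y Q + t * waterfilling σ A R T x y Q' ≤
      waterfilling σ A R T x y (((1 - t : ℝ) : ℂ) • Q + (t : ℂ) • Q') := by
  rw [waterfilling, waterfilling, waterfilling, one_add_G_mul_combo]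
  exact (logDet_concave (one_add_G_mul_posDef σ A R T x y hQ)
    (one_add_G_mul_posDef σ A R T x y hQ') ht0 ht1).1

lemma waterfilling_strictConcave (hσ : 0 < σ) (A : Matrix (Fin N) (Fin n) ℂ) (hR : R.PosSemidef)
    (hT : T.PosDef) (hx : 0 < x) (hy : 0 ≤ y) (hQ : Q.PosSemidef) (hQ' : Q'.PosSemidef)
    (hne : Q ≠ Q') {t : ℝ} (ht0 : 0 < t) (ht1 : t < 1) :
    (1 - t) * waterfilling σ A R T x y Q + t * waterfilling σ A R T x y Q' <
      waterfilling σ A R T x y (((1 - t : ℝ) : ℂ) • Q + (t : ℂ) • Q') := by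
  rw [waterfilling, waterfilling, waterfilling, one_add_G_mul_combo]
  refine (logDet_concave (one_add_G_mul_posDef σ A R T x y hQ)
    (one_add_G_mul_posDef σ A R T x y hQ') ht0.le ht1.le).2 ht0 ht1 fun h => hne ?_
  -- Strictness needs Q ↦ GQG to be injective; G² ≥ xT > 0 makes G invertible.
  have hG : IsUnit (G σ A R T x y) := by
    have hK := G_sq_posDef hσ A hR hT hx hy
    have h1 := hK.isUnit
    rw [← msqrt_mul_self hK.posSemidef, Matrix.isUnit_iff_isUnit_det, Matrix.det_mul] at h1
    rw [Matrix.isUnit_iff_isUnit_det]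
    exact isUnit_of_mul_isUnit_left h1
  exact hG.mul_left_cancel (hG.mul_right_cancel (add_left_cancel h))

/-- Continuity of the objective along segments. -/
lemma continuousAt_waterfilling_segment (σ : ℝ) (A : Matrix (Fin N) (Fin n) ℂ)
    (R : Matrix (Fin N) (Fin N) ℂ) (T : Matrix (Fin n) (Fin n) ℂ) (x y : ℝ) (hQ : Q.PosSemidef)
    (Q' : Matrix (Fin n) (Fin n) ℂ) :
    ContinuousAt (fun t : ℝ =>
      waterfilling σ A R T x y (((1 - t : ℝ) : ℂ) • Q + (t : ℂ) • Q')) 0 := by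
  refine ContinuousAt.log ?_ ?_
  · refine Complex.continuous_re.continuousAt.comp (Continuous.continuousAt ?_)
    refine Continuous.matrix_det ?_
    fun_prop
  · have := re_det_pos (one_add_G_mul_posDef σ A R T x y hQ)
    simpa using this.ne'

end MimoRician
end

/-! ### Profiles along κκ̃ = p, and the perturbation argument. -/

noncomputable section

namespace MimoRician

variable {N n : ℕ} {σ : ℝ} {R : Matrix (Fin N) (Fin N) ℂ} {T Q Q' : Matrix (Fin n) (Fin n) ℂ}
  {x y : ℝ}

open Filter Topology

/-- The function `log det [I + G Q G] + log det [I + κ' R]` along the curve `κ κ' = p`,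
parametrized by `κ = exp u`. -/
def profile (σ : ℝ) (A : Matrix (Fin N) (Fin n) ℂ) (R : Matrix (Fin N) (Fin N) ℂ)
    (T : Matrix (Fin n) (Fin n) ℂ) (p : ℝ) (Q : Matrix (Fin n) (Fin n) ℂ) (u : ℝ) : ℝ :=
  waterfilling σ A R T (Real.exp u) (p * Real.exp (-u)) Q +
    logDet (1 + ((p * Real.exp (-u) : ℝ) : ℂ) • R)

lemma profile_eq (hσ : 0 < σ) (A : Matrix (Fin N) (Fin n) ℂ) (hR : R.PosSemidef)
    (hT : T.PosDef) {p : ℝ} (hp : 0 < p) (hQ : Q.PosSemidef) :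
    profile σ A R T p Q = fun u =>
      logDetSum R (TQ T Q) (scaledMean σ A Q) (Real.exp u) (p * Real.exp (-u)) :=
  funext fun u => waterfilling_add_logDet hσ A hR hT hQ (Real.exp_pos u)
    (mul_pos hp (Real.exp_pos _)).le

lemma profile_strictConvexOn (hσ : 0 < σ) (A : Matrix (Fin N) (Fin n) ℂ) (hR : R.PosSemidef)
    (hT : T.PosDef) {p : ℝ} (hp : 0 < p) (hQ : Q ∈ C1 n) :
    StrictConvexOn ℝ Set.univ (profile σ A R T p Q) := by
  rw [profile_eq hσ A hR hT hp hQ.1]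
  exact strictConvexOn_logDetSum_exp hR (TQ_posSemidef hT.posSemidef Q)
    (TQ_ne_zero hT hQ.1 (ne_zero_of_mem_C1 hQ)) _ hp

lemma lt_of_strictConvexOn_of_hasDerivAt_zero {g : ℝ → ℝ} {u v : ℝ}
    (hg : StrictConvexOn ℝ Set.univ g) (hd : HasDerivAt g 0 u) (huv : v ≠ u) : g u < g v := by
  rcases lt_or_gt_of_ne huv with h | h
  · have h1 := hg.slope_lt_of_hasDerivAt (Set.mem_univ v) (Set.mem_univ u) h hd
    rw [slope_def_field, div_neg_iff] at h1
    rcases h1 with h1 | h1 <;> linarith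
  · have h1 := hg.lt_slope_of_hasDerivAt (Set.mem_univ u) (Set.mem_univ v) h hd
    rw [slope_def_field, div_pos_iff] at h1
    rcases h1 with h1 | h1 <;> linarith

/-- Along the curve `κ κ' = δ δ̃`, the profile has a strict global minimum at `κ = δ`. -/
lemma profile_lt_of_ne (hσ : 0 < σ) (A : Matrix (Fin N) (Fin n) ℂ) (hR : R.PosSemidef)
    (hT : T.PosDef) (hQ : Q ∈ C1 n) (h : IsCanonicalSolution σ A R T Q (x, y)) {u : ℝ}
    (hu : u ≠ Real.log x) :
    profile σ A R T (x * y) Q (Real.log x) < profile σ A R T (x * y) Q u := by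
  obtain ⟨hx, hy, e1, e2⟩ :=
    (isCanonicalSolution_iff hσ (card_pos_of_mem_C1 hQ) A hR hT.posSemidef _).1 h
  dsimp only at hx hy e1 e2
  refine lt_of_strictConvexOn_of_hasDerivAt_zero
    (profile_strictConvexOn hσ A hR hT (mul_pos hx hy) hQ) ?_ hu
  have hd := hasDerivAt_logDetSum_exp hR (TQ_posSemidef hT.posSemidef Q) (scaledMean σ A Q)
    (mul_pos hx hy) (Real.log x)
  have hxy : x * y * Real.exp (-Real.log x) = y := by
    rw [Real.exp_neg, Real.exp_log hx]
    field_simp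
  -- The canonical equations turn the derivative into x(cy) − y(cx) = 0.
  rw [hxy, Real.exp_log hx, ← e1, ← e2] at hd
  rw [profile_eq hσ A hR hT (mul_pos hx hy) hQ.1]
  convert hd using 1
  ring

/-- A convex-analytic perturbation lemma: a family of convex functions bounded below by
interpolations between `g₀`, strictly minimal at `a`, and `g₁`, continuous with `g₀ a < g₁ a`,
eventually exceeds `g₀ a` everywhere. -/
lemma exists_forall_lt_of_convexOn {g : ℝ → ℝ → ℝ} {g₁ : ℝ → ℝ} {a : ℝ}
    (hconv : ∀ t ∈ Set.Ioc (0 : ℝ) 1, ConvexOn ℝ Set.univ (g t))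
    (hinterp : ∀ t ∈ Set.Ioc (0 : ℝ) 1, ∀ u, (1 - t) * g 0 u + t * g₁ u ≤ g t u)
    (hmin : ∀ u, u ≠ a → g 0 a < g 0 u) (hcont : ∀ u, ContinuousAt (fun t => g t u) 0)
    (hg₁ : ContinuousAt g₁ a) (hlt : g 0 a < g₁ a) :
    ∃ t ∈ Set.Ioc (0 : ℝ) 1, ∀ u, g 0 a < g t u := by
  obtain ⟨ε, hε, hball⟩ := Metric.eventually_nhds_iff.1 (hg₁.eventually (lt_mem_nhds hlt))
  have hmin' (u : ℝ) : g 0 a ≤ g 0 u := by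
    by_cases h : u = a
    · rw [h]
    · exact (hmin u h).le
  -- Smallness of t is needed only to compare the values at a and a ± ε/2, so pointwise continuity
  -- in t suffices.
  have hev (b : ℝ) (hb : b ≠ a) : ∀ᶠ t in 𝓝[>] (0 : ℝ), g t a < g t b :=
    ((hcont a).eventually_lt (hcont b) (hmin b hb)).filter_mono nhdsWithin_le_nhds
  have hIoc : ∀ᶠ t in 𝓝[>] (0 : ℝ), t ∈ Set.Ioc (0 : ℝ) 1 := Ioc_mem_nhdsGT one_pos
  obtain ⟨t, ht, h1, h2⟩ := (hIoc.and ((hev (a + ε / 2) (by linarith)).and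
    (hev (a - ε / 2) (by linarith)))).exists
  have hnear (u : ℝ) (hu : |u - a| ≤ ε / 2) : g 0 a < g t u := by
    have h3 : g 0 a < g₁ u := hball (by rw [Real.dist_eq]; linarith)
    have h4 := hinterp t ht u
    nlinarith [mul_nonneg (sub_nonneg.2 ht.2) (sub_nonneg.2 (hmin' u)),
      mul_pos ht.1 (sub_pos.2 h3)]
  refine ⟨t, ht, fun u => ?_⟩
  -- Outside the interval, convexity applies: g t is larger at a ± ε/2 than at a, so it cannot fall
  -- below that endpoint value further out.
  rcases le_or_gt |u - a| (ε / 2) with hu | hu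
  · exact hnear u hu
  rcases lt_abs.1 hu with hu | hu
  · refine (hnear (a + ε / 2) (by rw [add_sub_cancel_left, abs_of_pos (half_pos hε)])).trans_le ?_
    exact (hconv t ht).le_right_of_left_le'' (Set.mem_univ a) (Set.mem_univ u) (by linarith)
      (by linarith) h1.le
  · refine (hnear (a - ε / 2) (by
      rw [sub_sub_cancel_left, abs_neg, abs_of_pos (half_pos hε)])).trans_le ?_
    exact (hconv t ht).le_left_of_right_le'' (Set.mem_univ u) (Set.mem_univ a) (by linarith)
      (by linarith) h2.le

/-- `Ī(Q)` dominates the minimum of the profile along every curve `κ κ' = p`. -/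
lemma profile_sub_le_Ibar (hσ : 0 < σ) (A : Matrix (Fin N) (Fin n) ℂ) (hR : R.PosSemidef)
    (hR0 : R ≠ 0) (hT : T.PosDef) (hQ : Q ∈ C1 n) {p : ℝ} (hp : 0 < p) :
    profile σ A R T p Q (Real.log (delta σ A R T Q)) - σ ^ 2 * n * p ≤ Ibar σ A R T Q := by
  have hcan := (existsUnique_canonicalSolution hσ A hR hR0 hT hQ).1
  rw [Ibar_eq hσ A hR hR0 hT hQ, profile_eq hσ A hR hT hp hQ.1]
  obtain ⟨hx, hy, e1, -⟩ :=
    (isCanonicalSolution_iff hσ (card_pos_of_mem_C1 hQ) A hR hT.posSemidef _).1 hcan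
  dsimp only at hx hy e1 ⊢
  have hpx : p * Real.exp (-Real.log (delta σ A R T Q)) = p / delta σ A R T Q := by
    rw [Real.exp_neg, Real.exp_log hx]
    rfl
  -- The tangent in y at (δ, δ̃) has slope cδ, so at y = p/δ its first-order term is c(p − δδ̃),
  -- exactly the difference of the two subtracted products.
  have h := logDetSum_le_right hR (TQ_posSemidef hT.posSemidef Q) (scaledMean σ A Q) hx.le hy.le
    (div_pos hp hx).le
  rw [← e1] at h
  rw [hpx, Real.exp_log hx]
  have h2 : p / delta σ A R T Q * delta σ A R T Q = p := div_mul_cancel₀ p hx.ne'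
  have h3 : (p / delta σ A R T Q - delta' σ A R T Q) * (σ ^ 2 * n * delta σ A R T Q) =
      σ ^ 2 * n * p - σ ^ 2 * n * delta σ A R T Q * delta' σ A R T Q := by
    linear_combination σ ^ 2 * n * h2
  linarith

lemma profile_at_delta (hσ : 0 < σ) (A : Matrix (Fin N) (Fin n) ℂ) (hR : R.PosSemidef)
    (hR0 : R ≠ 0) (hT : T.PosDef) (hQ : Q ∈ C1 n) (Q' : Matrix (Fin n) (Fin n) ℂ) :
    profile σ A R T (delta σ A R T Q * delta' σ A R T Q) Q' (Real.log (delta σ A R T Q)) =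
      waterfilling σ A R T (delta σ A R T Q) (delta' σ A R T Q) Q' +
        logDet (1 + (delta' σ A R T Q : ℂ) • R) := by
  have hx : 0 < delta σ A R T Q := (existsUnique_canonicalSolution hσ A hR hR0 hT hQ).1.1
  have hxy : delta σ A R T Q * delta' σ A R T Q * Real.exp (-Real.log (delta σ A R T Q)) =
      delta' σ A R T Q := by
    rw [Real.exp_neg, Real.exp_log hx]
    field_simp
  rw [profile, hxy, Real.exp_log hx]

/-- A maximizer of `Ī` maximizes its own water-filling objective. -/
theorem isMaxOn_waterfilling (hσ : 0 < σ) (A : Matrix (Fin N) (Fin n) ℂ) (hR : R.PosSemidef)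
    (hR0 : R ≠ 0) (hT : T.PosDef) (hQ : Q ∈ C1 n) (hmax : IsMaxOn (Ibar σ A R T) (C1 n) Q) :
    IsMaxOn (waterfilling σ A R T (delta σ A R T Q) (delta' σ A R T Q)) (C1 n) Q := by
  intro Q' hQ'
  by_contra hlt
  rw [Set.mem_ofPred_eq, not_le] at hlt
  have hcan := (existsUnique_canonicalSolution hσ A hR hR0 hT hQ).1
  have hp : 0 < delta σ A R T Q * delta' σ A R T Q := mul_pos hcan.1 hcan.2.1
  -- The product p stays frozen at its value for Q while the matrix moves towards Q'.
  set p := delta σ A R T Q * delta' σ A R T Q with hpdef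
  have hmem {t : ℝ} (ht : t ∈ Set.Ioc (0 : ℝ) 1) := convex_mem_C1 hQ hQ' ht.1.le ht.2
  have h0 : ((1 - (0 : ℝ) : ℝ) : ℂ) • Q + ((0 : ℝ) : ℂ) • Q' = Q := by simp
  obtain ⟨t, ht, hgt⟩ := exists_forall_lt_of_convexOn
    (g := fun t => profile σ A R T p (((1 - t : ℝ) : ℂ) • Q + (t : ℂ) • Q'))
    (g₁ := profile σ A R T p Q') (a := Real.log (delta σ A R T Q))
    (fun t ht => (profile_strictConvexOn hσ A hR hT hp (hmem ht)).convexOn)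
    (fun t ht u => by
      have := waterfilling_concave σ A R T (Real.exp u) (p * Real.exp (-u)) hQ.1 hQ'.1
        ht.1.le ht.2
      simp only [h0, profile]
      linarith)
    (fun u hu => by
      simp only [h0]
      exact profile_lt_of_ne hσ A hR hT hQ hcan hu)
    (fun u => (continuousAt_waterfilling_segment σ A R T _ _ hQ.1 Q').add continuousAt_const)
    (((profile_strictConvexOn hσ A hR hT hp hQ').convexOn.continuousOn isOpen_univ).continuousAt
      univ_mem)
    (by
      simp only [h0]
      rw [profile_at_delta hσ A hR hR0 hT hQ Q, profile_at_delta hσ A hR hR0 hT hQ Q']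
      linarith)
  have h1 := profile_sub_le_Ibar hσ A hR hR0 hT (hmem ht) hp
  -- The strict bound holds at every u, hence at the value belonging to the perturbed matrix, about
  -- which nothing else is known.
  have h2 := hgt (Real.log (delta σ A R T (((1 - t : ℝ) : ℂ) • Q + (t : ℂ) • Q')))
  have h3 : Ibar σ A R T (((1 - t : ℝ) : ℂ) • Q + (t : ℂ) • Q') ≤ Ibar σ A R T Q :=
    hmax (hmem ht)
  simp only [h0] at h2
  rw [profile_at_delta hσ A hR hR0 hT hQ Q] at h2
  have h4 : Ibar σ A R T Q = waterfilling σ A R T (delta σ A R T Q) (delta' σ A R T Q) Q +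
      logDet (1 + (delta' σ A R T Q : ℂ) • R) - σ ^ 2 * n * p := by
    rw [Ibar, waterfilling, hpdef]
    ring
  linarith

/-- The water-filling problem has at most one solution. -/
theorem waterfilling_maximizer_unique (hσ : 0 < σ) (A : Matrix (Fin N) (Fin n) ℂ)
    (hR : R.PosSemidef) (hT : T.PosDef) (hx : 0 < x) (hy : 0 ≤ y) (hQ : Q ∈ C1 n)
    (hQ' : Q' ∈ C1 n) (hmax : IsMaxOn (waterfilling σ A R T x y) (C1 n) Q)
    (hmax' : IsMaxOn (waterfilling σ A R T x y) (C1 n) Q') : Q = Q' := by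
  by_contra hne
  have h := waterfilling_strictConcave hσ A hR hT hx hy hQ.1 hQ'.1 hne
    (t := 1 / 2) (by norm_num) (by norm_num)
  have hmem := convex_mem_C1 hQ hQ' (t := 1 / 2) (by norm_num) (by norm_num)
  have h1 : _ ≤ waterfilling σ A R T x y Q := hmax hmem
  have h2 : _ ≤ waterfilling σ A R T x y Q' := hmax' hmem
  linarith

end MimoRician
end

theorem proposition3 {N n : ℕ} (σ : ℝ) (hσ : 0 < σ)
    (A : Matrix (Fin N) (Fin n) ℂ)
    (R : Matrix (Fin N) (Fin N) ℂ) (hR : R.PosSemidef) (hR0 : R ≠ 0)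
    (T : Matrix (Fin n) (Fin n) ℂ) (hT : T.PosDef) :
    -- the pair `(δ(Q), δ̃(Q))` is well defined for every `Q` in `𝒞₁`
    (∀ Q ∈ MimoRician.C1 n,
      MimoRician.IsCanonicalSolution σ A R T Q
          (MimoRician.delta σ A R T Q, MimoRician.delta' σ A R T Q) ∧
        ∀ p : ℝ × ℝ, MimoRician.IsCanonicalSolution σ A R T Q p →
          p = (MimoRician.delta σ A R T Q, MimoRician.delta' σ A R T Q)) ∧
    -- the maximizer of `Ī` is the unique solution of its water-filling problem
    ∀ Qs ∈ MimoRician.C1 n, IsMaxOn (MimoRician.Ibar σ A R T) (MimoRician.C1 n) Qs →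
      IsMaxOn (MimoRician.waterfilling σ A R T
          (MimoRician.delta σ A R T Qs) (MimoRician.delta' σ A R T Qs)) (MimoRician.C1 n) Qs ∧
        ∀ Q ∈ MimoRician.C1 n,
          IsMaxOn (MimoRician.waterfilling σ A R T
            (MimoRician.delta σ A R T Qs) (MimoRician.delta' σ A R T Qs)) (MimoRician.C1 n) Q →
          Q = Qs := by
  refine ⟨fun Q hQ => MimoRician.existsUnique_canonicalSolution hσ A hR hR0 hT hQ,
    fun Qs hQs hmax => ?_⟩
  have hcan := (MimoRician.existsUnique_canonicalSolution hσ A hR hR0 hT hQs).1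
  have hwf := MimoRician.isMaxOn_waterfilling hσ A hR hR0 hT hQs hmax
  exact ⟨hwf, fun Q hQ hQmax => MimoRician.waterfilling_maximizer_unique hσ A hR hT hcan.1
    hcan.2.1.le hQ hQs hQmax hwf⟩
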